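/- Theorem. Let $D=\{z\in\mathbb{C}:|z|<1\}$. All integrals of functions of a real variable are Henstock--Kurzweil integrals. For $f:\mathbb{R}\to\mathbb{R}$ that is $2\pi$-periodic and Henstock--Kurzweil integrable over every compact interval, let $$\|f\|:=\sup_{I}\Bigl|\int_I f\Bigr|$$ be its Alexiewicz norm, the supremum being over all intervals $I\subset\mathbb{R}$ of length at most $2\pi$. Let $\mathcal{HK}$ be the set of all such $f$ with $\|f\|<\infty$. For $u:D\to\mathbb{R}$ and $0\le r<1$ write $u_r(\theta):=u(re^{i\theta})$, and let $$h^{\mathcal{HK}}:=\Bigl\{u:D\to\mathbb{R}\;\Bigm|\;\Delta u=0\text{ in }D,\ \|u\|_{\mathcal{HK}}:=\sup_{0\le r<1}\|u_r\|<\infty\Bigr\}.$$ For $f\in\mathcal{HK}$ the Poisson integral of $f$ is $$P[f](re^{i\theta}):=\int_{-\pi}^{\pi}f(\phi)\,\Phi_r(\phi-\theta)\,d\phi,\qquad \Phi_r(\theta):=\frac{1-r^2}{2\pi(1-2r\cos\theta+r^2)}\qquad(0\le r<1).$$ Then $P[f]$ exists at every point of $D$ and belongs to $h^{\mathcal{HK}}$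 for every $f\in\mathcal{HK}$, and the mapping $P:\mathcal{HK}\to h^{\mathcal{HK}}$, $f\mapsto P[f]$, is an isometry into, but not onto, $h^{\mathcal{HK}}$. That is, $\|P[f]\|_{\mathcal{HK}}=\|f\|$ and $\|P[f]-P[g]\|_{\mathcal{HK}}=\|f-g\|$ for all $f,g\in\mathcal{HK}$, and there is $u\in h^{\mathcal{HK}}$ such that $u\ne P[f]$ for every $f\in\mathcal{HK}$. -/

import Mathlib

open scoped ENNReal

noncomputable section

namespace PoissonHK

/-- The interval with end points `a < b`, as a one-dimensional box. -/
def interval (a b : ℝ) (h : a < b) : BoxIntegral.Box (Fin 1) where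
  lower := fun _ => a
  upper := fun _ => b
  lower_lt_upper := fun _ => h

/-- Henstock--Kurzweil integrability of `f` over the interval `[a, b]`: the Riemann sums of `f`
over tagged partitions of `[a, b]` (each tag lying in its closed subinterval) subordinate to a
positive gauge converge. Nothing is required of a degenerate interval. -/
def HKIntegrable (f : ℝ → ℝ) (a b : ℝ) : Prop :=
  ∀ h : a < b, BoxIntegral.Integrable (interval a b h) BoxIntegral.IntegrationParams.Henstock
    (fun x : Fin 1 → ℝ => f (x 0)) BoxIntegral.BoxAdditiveMap.volume

/-- The Henstock--Kurzweil integral of `f` over `[a, b]`, for `a ≤ b` (zero if `a = b`). -/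
def hkIntegral (f : ℝ → ℝ) (a b : ℝ) : ℝ :=
  if h : a < b then
    BoxIntegral.integral (interval a b h) BoxIntegral.IntegrationParams.Henstock
      (fun x : Fin 1 → ℝ => f (x 0)) BoxIntegral.BoxAdditiveMap.volume
  else 0

/-- The Alexiewicz norm `sup_I |∫_I f|` over the intervals `I ⊆ ℝ` of length at most `2π`,
as an extended nonnegative real. -/
def alexiewiczNorm (f : ℝ → ℝ) : ℝ≥0∞ :=
  ⨆ (a : ℝ) (b : ℝ) (_ : a ≤ b ∧ b - a ≤ 2 * Real.pi), ENNReal.ofReal |hkIntegral f a b|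

/-- The space of `2π`-periodic functions that are Henstock--Kurzweil integrable over every
compact interval and have finite Alexiewicz norm. -/
def HK : Set (ℝ → ℝ) :=
  {f | Function.Periodic f (2 * Real.pi) ∧ (∀ a b : ℝ, HKIntegrable f a b) ∧
    alexiewiczNorm f < ⊤}

/-- The open unit disc. -/
def disc : Set ℂ := Metric.ball 0 1

/-- The Poisson kernel `Φ_r(θ)`. -/
def circlePoissonKernel (r θ : ℝ) : ℝ :=
  (1 - r ^ 2) / (2 * Real.pi * (1 - 2 * r * Real.cos θ + r ^ 2))

/-- The Poisson integral `P[f](z) = ∫_{-π}^{π} f(φ) Φ_r(φ - θ) dφ`, where `z = r e^{iθ}`. -/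
def poissonIntegral (f : ℝ → ℝ) (z : ℂ) : ℝ :=
  hkIntegral (fun φ => f φ * circlePoissonKernel ‖z‖ (φ - Complex.arg z)) (-Real.pi) Real.pi

/-- The function `u_r(θ) = u(r e^{iθ})`. -/
def circleSlice (u : ℂ → ℝ) (r : ℝ) : ℝ → ℝ :=
  fun θ => u (r * Complex.exp (θ * Complex.I))

/-- The norm `sup_{0 ≤ r < 1} ‖u_r‖`, where `‖·‖` is the Alexiewicz norm. -/
def hardyNorm (u : ℂ → ℝ) : ℝ≥0∞ :=
  ⨆ (r : ℝ) (_ : 0 ≤ r ∧ r < 1), alexiewiczNorm (circleSlice u r)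

/-- The harmonic Hardy space of the Alexiewicz norm. A function on the disc is represented by a
function on `ℂ`, of which only the values on the disc matter. -/
def hHK : Set (ℂ → ℝ) :=
  {u | InnerProductSpace.HarmonicOnNhd u disc ∧ hardyNorm u < ⊤}

end PoissonHK

end

/-! Everything rests on the indefinite integral F of f. Saks–Henstock makes F continuous, and
periodicity of f gives F(x + 2π) = F(x) + c with c = F(2π), so F(x) = G(x) + cx/(2π) with G
continuous and 2π-periodic.

Integration by parts turns P[f] into an ordinary integral of G against the derivative of the kernel.
With H(w) the average over the circle of G(φ)(ζ + w)/(ζ - w), ζ = e^{iφ}, it reads P[f](w) = c/(2π)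
+ Re(i w H'(w)). So P[f] is harmonic, and on each circle it is the θ-derivative of cθ/(2π) + Re
H(re^{iθ}). Hence the integral of P[f]_r over [a, b] is the average, with the probability density
Φ_r(φ), of the integrals of f over [a + φ, b + φ].

Averaging cannot increase the Alexiewicz norm, and as r → 1 the averages tend to the integral of f
over [a, b]; the two facts give the isometry. The Poisson kernel with pole at 1 is not in the range:
its slices have mass 1 concentrating at 0, so the primitive of a preimage would jump there.

Since f need not be absolutely integrable, integration by parts is proved on Riemann sums: the
strong Saks–Henstock lemma replaces f dx by dF, and a Stieltjes fundamental theorem evaluates the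
integral of k dF. -/

namespace PoissonHK

open BoxIntegral Set Filter Topology
open BoxIntegral.IntegrationParams (Henstock)

/-! ### One-dimensional boxes and the continuity of the indefinite integral -/

/-- The box-additive function `J ↦ F (J.upper) - F (J.lower)` on one-dimensional boxes. -/
noncomputable def endpointDiff (F : ℝ → ℝ) : BoxAdditiveMap (Fin 1) ℝ ⊤ :=
  BoxAdditiveMap.ofMapSplitAdd (fun J => F (J.upper 0) - F (J.lower 0)) ⊤ (by
    intro J _ i x hx
    obtain rfl : i = 0 := Subsingleton.elim _ _
    simp only [Box.splitLower_def hx, Box.splitUpper_def hx, Function.update_self,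
      ← WithBot.some_eq_coe, Option.elim']
    abel)

theorem endpointDiff_apply (F : ℝ → ℝ) (J : Box (Fin 1)) :
    endpointDiff F J = F (J.upper 0) - F (J.lower 0) := rfl

theorem eq_interval (J : Box (Fin 1)) :
    J = interval (J.lower 0) (J.upper 0) (J.lower_lt_upper 0) := by
  ext x
  simp [Box.mem_def, interval]

theorem integral_box_eq_hkIntegral (f : ℝ → ℝ) (J : Box (Fin 1)) :
    integral J Henstock (fun x => f (x 0)) BoxAdditiveMap.volume =
      hkIntegral f (J.lower 0) (J.upper 0) := by
  rw [hkIntegral, dif_pos (J.lower_lt_upper 0), ← eq_interval J]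

/-- Of the three flags only `bHenstock` is set in `Henstock`, so gauges are arbitrary and the
distortion clauses are vacuous. -/
theorem henstock_rCond (r : (Fin 1 → ℝ) → Ioi (0 : ℝ)) : Henstock.RCond r :=
  fun h => by simp [Henstock] at h

theorem henstock_memBaseSet {I : Box (Fin 1)} (c : NNReal) {r : (Fin 1 → ℝ) → Ioi (0 : ℝ)}
    {π : TaggedPrepartition I} (h₁ : π.IsSubordinate r) (h₂ : π.IsHenstock) :
    Henstock.MemBaseSet I c r π :=
  ⟨h₁, fun _ => h₂, fun h => by simp [Henstock] at h, fun h => by simp [Henstock] at h⟩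

theorem hkIntegral_add_adjacent {f : ℝ → ℝ} (hf : ∀ a b, HKIntegrable f a b) {a b c : ℝ}
    (hab : a ≤ b) (hbc : b ≤ c) :
    hkIntegral f a b + hkIntegral f b c = hkIntegral f a c := by
  rcases hab.eq_or_lt with rfl | hab
  · simp [hkIntegral]
  rcases hbc.eq_or_lt with rfl | hbc
  · simp [hkIntegral]
  have hac := hab.trans hbc
  have h := (hf a c hac).toBoxAdditive.map_split_add le_rfl 0 b
  have hb : b ∈ Ioo ((interval a c hac).lower 0) ((interval a c hac).upper 0) := ⟨hab, hbc⟩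
  rw [Box.splitLower_def hb, Box.splitUpper_def hb] at h
  simp only [Option.elim', Integrable.toBoxAdditive_apply,
    integral_box_eq_hkIntegral] at h
  simpa [interval] using h

/-- The indefinite Henstock--Kurzweil integral that vanishes at `0`. -/
noncomputable def hkPrimitive (f : ℝ → ℝ) (x : ℝ) : ℝ :=
  if 0 ≤ x then hkIntegral f 0 x else -hkIntegral f x 0

theorem hkIntegral_eq_sub {f : ℝ → ℝ} (hf : ∀ a b, HKIntegrable f a b) {a b : ℝ} (hab : a ≤ b) :
    hkIntegral f a b = hkPrimitive f b - hkPrimitive f a := by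
  unfold hkPrimitive
  split_ifs with hb ha ha
  · linarith [hkIntegral_add_adjacent hf ha hab]
  · linarith [hkIntegral_add_adjacent hf (not_le.1 ha).le hb]
  · linarith
  · linarith [hkIntegral_add_adjacent hf hab (not_le.1 hb).le]

theorem integral_box_eq_endpointDiff {f : ℝ → ℝ} (hf : ∀ a b, HKIntegrable f a b)
    (J : Box (Fin 1)) : integral J Henstock (fun x => f (x 0)) BoxAdditiveMap.volume =
      endpointDiff (hkPrimitive f) J := by
  rw [integral_box_eq_hkIntegral, hkIntegral_eq_sub hf (J.lower_lt_upper 0).le, endpointDiff_apply]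

theorem volume_box_apply (J : Box (Fin 1)) (y : ℝ) :
    BoxAdditiveMap.volume J y = (J.upper 0 - J.lower 0) * y := by
  simp [BoxAdditiveMap.volume_apply]

/-- Over a single small interval with tag `x`, a Riemann sum is close to the integral. -/
theorem exists_abs_sub_hkPrimitive_le {f : ℝ → ℝ} (hf : ∀ a b, HKIntegrable f a b) (x : ℝ)
    {ε : ℝ} (hε : 0 < ε) : ∃ δ > 0, ∀ a b, a < b → a ∈ Icc (x - δ) (x + δ) →
      b ∈ Icc (x - δ) (x + δ) → x ∈ Icc a b →
        |(b - a) * f x - (hkPrimitive f b - hkPrimitive f a)| ≤ ε := by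
  have hI : x - 1 < x + 1 := by linarith
  have h := hf _ _ hI
  obtain ⟨r, hr⟩ : ∃ r, r = h.convergenceR ε 0 (fun _ => x) := ⟨_, rfl⟩
  have hr0 : 0 < (r : ℝ) := r.2
  refine ⟨min r 1, lt_min hr0 one_pos, fun a b hab ha hb hx => ?_⟩
  have h1 := min_le_left (r : ℝ) 1
  have h2 := min_le_right (r : ℝ) 1
  have hJ : interval a b hab ≤ interval _ _ hI := by
    rw [Box.le_iff_bounds]
    constructor
    · intro i; simp only [interval]; linarith [ha.1]
    · intro i; simp only [interval]; linarith [hb.2]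
  have hx' : (fun _ => x) ∈ Box.Icc (interval a b hab) := ⟨fun _ => hx.1, fun _ => hx.2⟩
  have hxI : (fun _ => x) ∈ Box.Icc (interval _ _ hI) := Box.le_iff_Icc.1 hJ hx'
  -- Saks–Henstock applies to partial partitions, in particular to the single interval [a, b] with
  -- tag x.
  have key := h.dist_integralSum_sum_integral_le_of_memBaseSet (c := 0) hε
    (π := TaggedPrepartition.single _ _ hJ _ hxI) (henstock_memBaseSet 0
      ((TaggedPrepartition.isSubordinate_single _ _).2 fun y hy => ?_)
      ((TaggedPrepartition.isHenstock_single_iff _ _).2 hx'))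
  · simpa only [integralSum, TaggedPrepartition.single, Prepartition.single, volume_box_apply,
      Real.dist_eq, integral_box_eq_endpointDiff hf, endpointDiff_apply, interval,
      Finset.sum_singleton] using key
  · rw [Metric.mem_closedBall, dist_pi_le_iff (by rw [← hr]; exact hr0.le), ← hr]
    intro i
    have h3 : a ≤ y i := hy.1 i
    have h4 : y i ≤ b := hy.2 i
    rw [Real.dist_eq, abs_le]
    constructor <;> linarith [ha.1, hb.2]

/-- The increment of the primitive is within ε/2 of (y - x) f(x), a quantity that vanishes as y → x
with x fixed. No bound on f near x is needed. -/
theorem continuous_hkPrimitive {f : ℝ → ℝ} (hf : ∀ a b, HKIntegrable f a b) :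
    Continuous (hkPrimitive f) := by
  rw [continuous_iff_continuousAt]
  intro x
  rw [Metric.continuousAt_iff]
  intro ε hε
  obtain ⟨δ, hδ, H⟩ := exists_abs_sub_hkPrimitive_le hf x (half_pos hε)
  have hM : 0 < 2 * (|f x| + 1) := by positivity
  refine ⟨min δ (ε / (2 * (|f x| + 1))), lt_min hδ (by positivity), fun {y} hy => ?_⟩
  have h1 := lt_of_lt_of_le hy (min_le_left _ _)
  have h2 := lt_of_lt_of_le hy (min_le_right _ _)
  rw [lt_div_iff₀ hM] at h2
  rw [Real.dist_eq] at h1 h2 ⊢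
  have h3 : |(y - x) * f x| < ε / 2 := by
    rw [abs_mul]
    have : 0 < ε := hε
    rcases (abs_nonneg (y - x)).eq_or_lt with h0 | h0
    · rw [← h0, zero_mul]; linarith
    · nlinarith
  have h1' := abs_lt.1 h1
  have h4 : |(y - x) * f x - (hkPrimitive f y - hkPrimitive f x)| ≤ ε / 2 := by
    rcases lt_trichotomy x y with hxy | rfl | hxy
    · exact H x y hxy ⟨by linarith, by linarith⟩ ⟨by linarith, by linarith⟩ ⟨le_rfl, hxy.le⟩
    · simpa using (half_pos hε).le
    · have := H y x hxy ⟨by linarith, by linarith⟩ ⟨by linarith, by linarith⟩ ⟨hxy.le, le_rfl⟩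
      rw [← abs_neg]
      convert this using 2; ring
  have h5 := abs_lt.1 h3
  have h6 := abs_le.1 h4
  rw [abs_lt]
  constructor <;> linarith

/-! ### Fundamental theorem, strong Saks–Henstock lemma and integration by parts -/

/-- A Stieltjes form of the fundamental theorem of calculus: if, for each `x`, the function
`y ↦ V y * k x - ψ y` has derivative `0` at `x`, then `∫ k dV = ψ b - ψ a`. -/
theorem hasIntegral_of_hasDerivAt_zero {V k ψ : ℝ → ℝ}
    (h : ∀ x, HasDerivAt (fun y => V y * k x - ψ y) 0 x) (I : Box (Fin 1)) :
    HasIntegral I Henstock (fun x => k (x 0)) (endpointDiff V).toSMul (endpointDiff ψ I) := by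
  refine HasIntegral.of_le_Henstock_of_forall_isLittleO le_rfl
    ((endpointDiff id).restrict I le_top) (fun J => ?_) ((endpointDiff ψ).restrict I le_top) ∅
    countable_empty (by simp) ?_
  · simpa [endpointDiff_apply] using (J.lower_lt_upper 0).le
  intro _ x _ ε hε
  have hd := (h (x 0)).isLittleO.def hε
  rw [Metric.eventually_nhds_iff_ball] at hd
  obtain ⟨δ, hδ, H⟩ := hd
  refine ⟨δ / 2, half_pos hδ, fun J _ hJ hxJ _ => ?_⟩
  have hl := hJ J.lower_mem_Icc
  have hu := hJ J.upper_mem_Icc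
  have hl' := H (J.lower 0) (Metric.mem_ball.2 (lt_of_le_of_lt
    ((dist_le_pi_dist J.lower x 0).trans (Metric.mem_closedBall.1 hl)) (half_lt_self hδ)))
  have hu' := H (J.upper 0) (Metric.mem_ball.2 (lt_of_le_of_lt
    ((dist_le_pi_dist J.upper x 0).trans (Metric.mem_closedBall.1 hu)) (half_lt_self hδ)))
  have h1 : J.lower 0 ≤ x 0 := hxJ.1 0
  have h2 : x 0 ≤ J.upper 0 := hxJ.2 0
  simp only [smul_zero, sub_zero, Real.norm_eq_abs] at hl' hu'
  -- As the tag lies between the end points, the two errors ε|lower - x| and ε|upper - x| add up to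
  -- ε times the length of J.
  rw [abs_of_nonpos (sub_nonpos.2 h1)] at hl'
  rw [abs_of_nonneg (sub_nonneg.2 h2)] at hu'
  have h3 := abs_le.1 hl'
  have h4 := abs_le.1 hu'
  simp only [BoxAdditiveMap.toSMul_apply, BoxAdditiveMap.restrict_apply, endpointDiff_apply,
    smul_eq_mul, id, Real.dist_eq]
  rw [abs_le]
  constructor <;> linarith

theorem endpointDiff_id_toSMul :
    ((endpointDiff id).toSMul : BoxAdditiveMap (Fin 1) (ℝ →L[ℝ] ℝ) ⊤) =
      BoxAdditiveMap.volume := by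
  ext J
  simp [BoxAdditiveMap.toSMul_apply, endpointDiff_apply, volume_box_apply]

theorem hasIntegral_of_hasDerivAt {Q q : ℝ → ℝ} (h : ∀ x, HasDerivAt Q (q x) x)
    (I : Box (Fin 1)) :
    HasIntegral I Henstock (fun x => q (x 0)) BoxAdditiveMap.volume (endpointDiff Q I) := by
  rw [← endpointDiff_id_toSMul]
  refine hasIntegral_of_hasDerivAt_zero (fun x => ?_) I
  have := ((hasDerivAt_id x).mul_const (q x)).sub (h x)
  rw [one_mul, sub_self] at this
  exact this

theorem hkIntegral_of_hasDerivAt {Q q : ℝ → ℝ} (h : ∀ x, HasDerivAt Q (q x) x) {a b : ℝ}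
    (hab : a ≤ b) : hkIntegral q a b = Q b - Q a := by
  rcases hab.eq_or_lt with rfl | hab
  · simp [hkIntegral]
  · rw [hkIntegral, dif_pos hab, (hasIntegral_of_hasDerivAt h _).integral_eq]
    rfl

/-- The strong form of the Saks--Henstock lemma. -/
theorem sum_abs_sub_integral_le {I : Box (Fin 1)} {f : (Fin 1 → ℝ) → ℝ}
    (h : Integrable I Henstock f BoxAdditiveMap.volume) {ε : ℝ} (hε : 0 < ε) {c : NNReal}
    {π : TaggedPrepartition I} (hπ : Henstock.MemBaseSet I c (h.convergenceR ε c) π) :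
    ∑ J ∈ π.boxes, |BoxAdditiveMap.volume J (f (π.tag J)) -
      integral J Henstock f BoxAdditiveMap.volume| ≤ 2 * ε := by
  classical
  set D : Box (Fin 1) → ℝ := fun J => BoxAdditiveMap.volume J (f (π.tag J)) -
      integral J Henstock f BoxAdditiveMap.volume with hD
  -- Any subfamily of the partition obeys the usual Saks–Henstock bound; the boxes with D ≥ 0 and
  -- those with D < 0 contribute at most ε each.
  have key : ∀ (p : Box (Fin 1) → Prop) [DecidablePred p],
      |∑ J ∈ π.boxes with p J, D J| ≤ ε := by
    intro p _
    have := h.dist_integralSum_sum_integral_le_of_memBaseSet hε (hπ.filter p)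
    rw [Real.dist_eq, integralSum, ← Finset.sum_sub_distrib] at this
    convert! this using 3
    ext J
    exact Finset.mem_filter.trans π.mem_filter.symm
  rw [← Finset.sum_filter_add_sum_filter_not π.boxes (fun J => 0 ≤ D J)]
  have h1 : ∑ J ∈ π.boxes with 0 ≤ D J, |D J| ≤ ε := by
    rw [Finset.sum_congr rfl fun J hJ => abs_of_nonneg (Finset.mem_filter.1 hJ).2]
    exact (le_abs_self _).trans (key _)
  have h2 : ∑ J ∈ π.boxes with ¬ 0 ≤ D J, |D J| ≤ ε := by
    rw [Finset.sum_congr rfl fun J hJ => abs_of_neg (not_le.1 (Finset.mem_filter.1 hJ).2),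
      Finset.sum_neg_distrib]
    exact (neg_le_abs _).trans (key _)
  linarith

/-- If `F` is the indefinite integral of `f`, then `∫ f k = ∫ k dF` for bounded `k`. -/
theorem hasIntegral_mul_of_stieltjes {f k : ℝ → ℝ} (hf : ∀ a b, HKIntegrable f a b) {M y : ℝ}
    (hk : ∀ x, |k x| ≤ M) {I : Box (Fin 1)}
    (h : HasIntegral I Henstock (fun x => k (x 0)) (endpointDiff (hkPrimitive f)).toSMul y) :
    HasIntegral I Henstock (fun x => f (x 0) * k (x 0)) BoxAdditiveMap.volume y := by
  have hfI : Integrable I Henstock (fun x => f (x 0)) BoxAdditiveMap.volume := by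
    rw [eq_interval I]; exact hf _ _ _
  -- Replacing f dx by dF costs M · 2ε, and the Stieltjes sum is within ε of its limit.
  refine HasIntegral.of_mul (2 * M + 1) fun ε hε => ?_
  obtain ⟨r, hr, H⟩ := hasIntegral_iff.1 h ε hε
  refine ⟨fun c x => min (r c x) (hfI.convergenceR ε c x), fun c => henstock_rCond _,
    fun c π hπ hp => ?_⟩
  have h1 := H c π (hπ.mono' I le_rfl le_rfl fun J _ => min_le_left _ _) hp
  have h2 := sum_abs_sub_integral_le hfI hε (c := c) (π := π)
    (hπ.mono' I le_rfl le_rfl fun J _ => min_le_right _ _)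
  have h3 : |integralSum (fun x => f (x 0) * k (x 0)) BoxAdditiveMap.volume π -
      integralSum (fun x => k (x 0)) (endpointDiff (hkPrimitive f)).toSMul π| ≤ M * (2 * ε) := by
    have hM : 0 ≤ M := (abs_nonneg _).trans (hk 0)
    refine le_trans ?_ (mul_le_mul_of_nonneg_left h2 hM)
    rw [integralSum, integralSum, ← Finset.sum_sub_distrib, Finset.mul_sum]
    refine (Finset.abs_sum_le_sum_abs _ _).trans (Finset.sum_le_sum fun J _ => ?_)
    rw [integral_box_eq_endpointDiff hf, BoxAdditiveMap.toSMul_apply, volume_box_apply,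
      volume_box_apply, smul_eq_mul, ← mul_assoc, ← sub_mul, abs_mul, mul_comm]
    exact mul_le_mul_of_nonneg_right (hk _) (abs_nonneg _)
  rw [Real.dist_eq] at h1 ⊢
  calc _ ≤ _ := abs_sub_le _ (integralSum (fun x => k (x 0))
          (endpointDiff (hkPrimitive f)).toSMul π) _
    _ ≤ M * (2 * ε) + ε := add_le_add h3 h1
    _ = (2 * M + 1) * ε := by ring

/-- **Integration by parts** for the Henstock--Kurzweil integral. -/
theorem hasIntegral_mul {f k k' Q : ℝ → ℝ} (hf : ∀ a b, HKIntegrable f a b) {M : ℝ}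
    (hM : ∀ x, |k x| ≤ M) (hk : ∀ x, HasDerivAt k (k' x) x)
    (hQ : ∀ x, HasDerivAt Q (hkPrimitive f x * k' x) x) (I : Box (Fin 1)) :
    HasIntegral I Henstock (fun x => f (x 0) * k (x 0)) BoxAdditiveMap.volume
      (endpointDiff (fun x => hkPrimitive f x * k x - Q x) I) := by
  refine hasIntegral_mul_of_stieltjes hf hM (hasIntegral_of_hasDerivAt_zero (fun x => ?_) I)
  -- F need not be differentiable: the factor k(y) - k(x) vanishes at x, so the difference quotient
  -- is F(y) times the slope of k, and continuity of F suffices.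
  have h1 : HasDerivAt (fun y => hkPrimitive f y * (k y - k x)) (hkPrimitive f x * k' x) x := by
    rw [hasDerivAt_iff_tendsto_slope]
    have h2 := ((continuous_hkPrimitive hf).tendsto x).mono_left nhdsWithin_le_nhds |>.mul
      (hasDerivAt_iff_tendsto_slope.1 (hk x))
    refine h2.congr fun y => ?_
    simp [slope_def_field]
    ring
  have := (hQ x).sub h1
  simp only [sub_self] at this
  refine this.congr_deriv rfl |>.congr_of_eventuallyEq (Eventually.of_forall fun y => ?_)
  simp only [Pi.sub_apply]
  ring

theorem hkIntegrable_mul {f k k' Q : ℝ → ℝ} (hf : ∀ a b, HKIntegrable f a b) {M : ℝ}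
    (hM : ∀ x, |k x| ≤ M) (hk : ∀ x, HasDerivAt k (k' x) x)
    (hQ : ∀ x, HasDerivAt Q (hkPrimitive f x * k' x) x) (a b : ℝ) :
    HKIntegrable (fun x => f x * k x) a b :=
  fun _ => (hasIntegral_mul hf hM hk hQ _).integrable

theorem hkIntegral_mul {f k k' Q : ℝ → ℝ} (hf : ∀ a b, HKIntegrable f a b) {M : ℝ}
    (hM : ∀ x, |k x| ≤ M) (hk : ∀ x, HasDerivAt k (k' x) x)
    (hQ : ∀ x, HasDerivAt Q (hkPrimitive f x * k' x) x) {a b : ℝ} (hab : a < b) :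
    hkIntegral (fun x => f x * k x) a b =
      (hkPrimitive f b * k b - Q b) - (hkPrimitive f a * k a - Q a) := by
  rw [hkIntegral, dif_pos hab, (hasIntegral_mul hf hM hk hQ _).integral_eq]
  rfl

/-! ### Translation invariance and periodicity -/

/-- The translate of a one-dimensional box. -/
def shiftBox (t : ℝ) (J : Box (Fin 1)) : Box (Fin 1) where
  lower := fun i => J.lower i + t
  upper := fun i => J.upper i + t
  lower_lt_upper := fun i => by simp

theorem mem_shiftBox {t : ℝ} {J : Box (Fin 1)} {x : Fin 1 → ℝ} :
    x ∈ shiftBox t J ↔ (fun i => x i - t) ∈ J := by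
  simp [Box.mem_def, shiftBox, lt_sub_iff_add_lt]

theorem mem_Icc_shiftBox {t : ℝ} {J : Box (Fin 1)} {x : Fin 1 → ℝ} :
    x ∈ Box.Icc (shiftBox t J) ↔ (fun i => x i - t) ∈ Box.Icc J := by
  simp [Box.Icc_def, shiftBox, Pi.le_def, le_sub_iff_add_le]

theorem shiftBox_shiftBox_neg (t : ℝ) (J : Box (Fin 1)) : shiftBox (-t) (shiftBox t J) = J := by
  ext x
  simp [mem_shiftBox]

theorem shiftBox_injective (t : ℝ) : Function.Injective (shiftBox t) := fun J J' h => by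
  rw [← shiftBox_shiftBox_neg t J, ← shiftBox_shiftBox_neg t J', h]

/-- The translate of a tagged prepartition. -/
def shiftPrepartition (t : ℝ) {I : Box (Fin 1)} (π : TaggedPrepartition I) :
    TaggedPrepartition (shiftBox t I) where
  boxes := π.boxes.map ⟨shiftBox t, shiftBox_injective t⟩
  le_of_mem' := by
    intro J' hJ' x hx
    obtain ⟨J, hJ, rfl⟩ := Finset.mem_map.1 hJ'
    exact mem_shiftBox.2 (π.le_of_mem' J hJ (mem_shiftBox.1 hx))
  pairwiseDisjoint := by
    intro J₁' h₁ J₂' h₂ hne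
    obtain ⟨J₁, hJ₁, rfl⟩ := Finset.mem_map.1 (Finset.mem_coe.1 h₁)
    obtain ⟨J₂, hJ₂, rfl⟩ := Finset.mem_map.1 (Finset.mem_coe.1 h₂)
    have hd := π.pairwiseDisjoint hJ₁ hJ₂ (fun h => hne (by rw [h]))
    rw [Function.onFun, Set.disjoint_left] at hd ⊢
    exact fun x hx hx' => hd (mem_shiftBox.1 hx) (mem_shiftBox.1 hx')
  tag := fun J i => π.tag (shiftBox (-t) J) i + t
  tag_mem_Icc := fun J => mem_Icc_shiftBox.2 (by simpa using π.tag_mem_Icc _)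

/-- Translating boxes and tags carries partitions of I subordinate to the translated gauge to
partitions of `shiftBox t I` subordinate to the original one, with equal Riemann sums. -/
theorem hasIntegral_comp_add {f : ℝ → ℝ} {t : ℝ} {I : Box (Fin 1)} {y : ℝ}
    (h : HasIntegral (shiftBox t I) Henstock (fun x => f (x 0)) BoxAdditiveMap.volume y) :
    HasIntegral I Henstock (fun x => f (x 0 + t)) BoxAdditiveMap.volume y := by
  rw [hasIntegral_iff] at h ⊢
  intro ε hε
  obtain ⟨r, hr, H⟩ := h ε hε
  refine ⟨fun c x => r c (fun i => x i + t), fun c => henstock_rCond _, fun c π hπ hp => ?_⟩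
  have hmem : ∀ J', J' ∈ shiftPrepartition t π → ∃ J ∈ π, shiftBox t J = J' :=
    fun J' hJ' => Finset.mem_map.1 hJ'
  have key := H c (shiftPrepartition t π) (henstock_memBaseSet c ?_ ?_) ?_
  · convert key using 2
    rw [integralSum, integralSum]
    simp only [shiftPrepartition, Finset.sum_map]
    refine Finset.sum_congr rfl fun J _ => ?_
    rw [Function.Embedding.coeFn_mk, shiftBox_shiftBox_neg, volume_box_apply, volume_box_apply]
    simp [shiftBox]
  · intro J' hJ' x hx
    obtain ⟨J, hJ, rfl⟩ := hmem J' hJ'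
    have h1 := hπ.isSubordinate J hJ (mem_Icc_shiftBox.1 hx)
    rw [Metric.mem_closedBall, dist_pi_le_iff (r c _).2.le] at h1 ⊢
    intro i
    have := h1 i
    simp only [shiftPrepartition, shiftBox_shiftBox_neg, Real.dist_eq] at this ⊢
    convert this using 2
    ring
  · intro J' hJ'
    obtain ⟨J, hJ, rfl⟩ := hmem J' hJ'
    rw [mem_Icc_shiftBox]
    simpa [shiftPrepartition, shiftBox_shiftBox_neg] using hπ.isHenstock rfl J hJ
  · intro x hx
    obtain ⟨J, hJ, hxJ⟩ := hp _ (mem_shiftBox.1 hx)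
    exact ⟨shiftBox t J, Finset.mem_map.2 ⟨J, hJ, rfl⟩, mem_shiftBox.2 hxJ⟩

theorem hkIntegral_add_period {f : ℝ → ℝ} {T : ℝ} (hT : Function.Periodic f T)
    (hf : ∀ a b, HKIntegrable f a b) (a b : ℝ) :
    hkIntegral f (a + T) (b + T) = hkIntegral f a b := by
  unfold hkIntegral
  split_ifs with h1 h2 h2
  · have h := hasIntegral_comp_add (t := T) (I := interval a b h2) (hf _ _ h1).hasIntegral
    simp only [hT _] at h
    exact h.integral_eq.symm
  · exact absurd (by linarith) h2
  · exact absurd (by linarith) h1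
  · rfl

theorem hkPrimitive_add_period {f : ℝ → ℝ} {T : ℝ} (hT : Function.Periodic f T)
    (hf : ∀ a b, HKIntegrable f a b) (x : ℝ) :
    hkPrimitive f (x + T) = hkPrimitive f x + hkPrimitive f T := by
  have h0 : hkPrimitive f 0 = 0 := by simp [hkPrimitive, hkIntegral]
  rcases le_total 0 x with hx | hx
  · have h1 := hkIntegral_eq_sub hf hx
    have h2 := hkIntegral_eq_sub hf (show 0 + T ≤ x + T by linarith)
    rw [hkIntegral_add_period hT hf, zero_add] at h2
    linarith
  · have h1 := hkIntegral_eq_sub hf hx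
    have h2 := hkIntegral_eq_sub hf (show x + T ≤ 0 + T by linarith)
    rw [hkIntegral_add_period hT hf, zero_add] at h2
    linarith

end PoissonHK

namespace PoissonHK

open Set Filter Topology Complex MeasureTheory

/-! ### The Poisson kernel -/

theorem ofReal_mul_exp_mem_disc {r : ℝ} (h0 : 0 ≤ r) (h1 : r < 1) (θ : ℝ) :
    (r * exp (θ * I) : ℂ) ∈ Metric.ball (0 : ℂ) 1 := by
  simp [abs_of_nonneg h0, h1]

theorem circleMap_sub_ne_zero {w : ℂ} (hw : w ∈ Metric.ball (0 : ℂ) 1) (φ : ℝ) :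
    circleMap 0 1 φ - w ≠ 0 :=
  sub_ne_zero.2 (circleMap_ne_mem_ball hw φ)

/-- The link between the trigonometric kernel and Re((ζ + w)/(ζ - w)), which is where holomorphy in
w enters. -/
theorem circlePoissonKernel_eq {r : ℝ} (θ φ : ℝ) :
    circlePoissonKernel r (φ - θ) =
      (herglotzRieszKernel 0 (r * exp (θ * I)) (circleMap 0 1 φ)).re / (2 * Real.pi) := by
  have h := congrFun (poissonKernel_eq_re_herglotzRieszKernel (c := 0) (w := r * exp (θ * I)))
    (circleMap 0 1 φ)
  simp only [Function.comp_apply] at h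
  rw [← h, poissonKernel_def, circlePoissonKernel, div_div, mul_comm (2 * Real.pi)]
  have h1 : ‖circleMap 0 1 φ - 0‖ ^ 2 - ‖(r * exp (θ * I) : ℂ) - 0‖ ^ 2 = 1 - r ^ 2 := by
    simp
  have h2 : ‖circleMap 0 1 φ - 0 - ((r * exp (θ * I) : ℂ) - 0)‖ ^ 2 =
      1 - 2 * r * Real.cos (φ - θ) + r ^ 2 := by
    rw [← normSq_eq_norm_sq, normSq_apply]
    simp only [circleMap, sub_zero, zero_add, ofReal_one, one_mul, exp_ofReal_mul_I, sub_re,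
      sub_im, mul_re, mul_im, add_re, add_im, ofReal_re, ofReal_im, I_re, I_im, Real.cos_sub]
    nlinarith [Real.sin_sq_add_cos_sq φ, Real.sin_sq_add_cos_sq θ]
  rw [h1, h2]

theorem circlePoissonKernel_arg (w : ℂ) (φ : ℝ) :
    circlePoissonKernel ‖w‖ (φ - arg w) =
      (herglotzRieszKernel 0 w (circleMap 0 1 φ)).re / (2 * Real.pi) := by
  rw [circlePoissonKernel_eq, norm_mul_exp_arg_mul_I]

/-- The denominator of the Poisson kernel is positive. -/
theorem circlePoissonKernel_denom_pos {r : ℝ} (h0 : 0 ≤ r) (h1 : r < 1) (θ : ℝ) :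
    0 < 1 - 2 * r * Real.cos θ + r ^ 2 := by
  nlinarith [Real.cos_le_one θ, mul_nonneg h0 (sub_nonneg.2 (Real.cos_le_one θ)),
    mul_pos (sub_pos.2 h1) (sub_pos.2 h1)]

theorem continuous_circlePoissonKernel {r : ℝ} (h0 : 0 ≤ r) (h1 : r < 1) :
    Continuous (circlePoissonKernel r) := by
  unfold circlePoissonKernel
  refine Continuous.div (by fun_prop) (by fun_prop) fun θ => ?_
  have := circlePoissonKernel_denom_pos h0 h1 θ
  have := Real.pi_pos
  positivity

theorem circlePoissonKernel_nonneg {r : ℝ} (h0 : 0 ≤ r) (h1 : r < 1) (θ : ℝ) :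
    0 ≤ circlePoissonKernel r θ := by
  have := circlePoissonKernel_denom_pos h0 h1 θ
  have := Real.pi_pos
  have : 0 ≤ 1 - r ^ 2 := by nlinarith
  unfold circlePoissonKernel
  positivity

theorem periodic_circlePoissonKernel (r : ℝ) :
    Function.Periodic (circlePoissonKernel r) (2 * Real.pi) := fun θ => by
  simp [circlePoissonKernel]

theorem circlePoissonKernel_neg (r θ : ℝ) :
    circlePoissonKernel r (-θ) = circlePoissonKernel r θ := by
  simp [circlePoissonKernel]

/-- The denominator contains (1 - r)² + 2r(1 - cos θ) ≥ 2r(1 - cos θ). The bound is uniform in θ and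
tends to 0 as r → 1, so it measures the concentration of the kernel. -/
theorem circlePoissonKernel_mul_one_sub_cos_le {r : ℝ} (h0 : 0 < r) (h1 : r < 1) (θ : ℝ) :
    circlePoissonKernel r θ * (1 - Real.cos θ) ≤ (1 - r ^ 2) / (4 * Real.pi * r) := by
  have hd := circlePoissonKernel_denom_pos h0.le h1 θ
  have hp := Real.pi_pos
  have hr : 0 ≤ 1 - r ^ 2 := by nlinarith
  have hc := sub_nonneg.2 (Real.cos_le_one θ)
  rw [circlePoissonKernel, div_mul_eq_mul_div, div_le_div_iff₀ (by positivity) (by positivity),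
    mul_assoc]
  refine mul_le_mul_of_nonneg_left ?_ hr
  nlinarith [mul_nonneg hp.le (sq_nonneg (1 - r))]

theorem continuous_herglotzRieszKernel_circleMap {w : ℂ} (hw : w ∈ Metric.ball (0 : ℂ) 1) :
    Continuous (fun φ : ℝ => herglotzRieszKernel 0 w (circleMap 0 1 φ)) := by
  simp only [herglotzRieszKernel_def, sub_zero]
  exact Continuous.div (by fun_prop) (by fun_prop) (circleMap_sub_ne_zero hw)

/-- The φ-derivative is -i w times the w-derivative 2ζ/(ζ - w)² of the same kernel. This converts
integration by parts in φ into differentiation in w. -/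
theorem hasDerivAt_herglotzRieszKernel_circleMap {w : ℂ} (hw : w ∈ Metric.ball (0 : ℂ) 1)
    (φ : ℝ) : HasDerivAt (fun φ : ℝ => herglotzRieszKernel 0 w (circleMap 0 1 φ))
      (-(I * w * (2 * circleMap 0 1 φ / (circleMap 0 1 φ - w) ^ 2))) φ := by
  have h := circleMap_sub_ne_zero hw φ
  have hc := hasDerivAt_circleMap 0 1 φ
  simp only [herglotzRieszKernel_def, sub_zero]
  convert! (hc.add_const w).div (hc.sub_const w) h using 1
  field_simp
  ring

/-- This is the Poisson representation of the constant harmonic function 1. -/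
theorem integral_circlePoissonKernel {r : ℝ} (h0 : 0 ≤ r) (h1 : r < 1) :
    ∫ φ in (0)..(2 * Real.pi), circlePoissonKernel r φ = 1 := by
  have hw := ofReal_mul_exp_mem_disc h0 h1 0
  have h := InnerProductSpace.HarmonicOnNhd.circleAverage_re_herglotzRieszKernel_smul
    (f := fun _ => 1) (fun z _ => InnerProductSpace.harmonicAt_const 1) hw
  rw [Real.circleAverage_def] at h
  have h2 : ∀ φ, circlePoissonKernel r φ = (2 * Real.pi)⁻¹ *
      (herglotzRieszKernel 0 (r * exp ((0 : ℝ) * I)) (circleMap 0 1 φ)).re := fun φ => by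
    rw [← div_eq_inv_mul, ← circlePoissonKernel_eq, sub_zero]
  simp only [h2, intervalIntegral.integral_const_mul]
  simpa using h

theorem integral_eq_of_periodic {q : ℝ → ℝ} (hq : Function.Periodic q (2 * Real.pi)) (a b : ℝ) :
    ∫ φ in a..(a + 2 * Real.pi), q φ = ∫ φ in b..(b + 2 * Real.pi), q φ :=
  hq.intervalIntegral_add_eq a b

theorem integral_neg_pi_pi_eq {q : ℝ → ℝ} (hq : Function.Periodic q (2 * Real.pi)) :
    ∫ φ in (-Real.pi)..Real.pi, q φ = ∫ φ in (0)..(2 * Real.pi), q φ := by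
  have h := hq.intervalIntegral_add_eq (-Real.pi) 0
  rwa [zero_add, show -Real.pi + 2 * Real.pi = Real.pi by ring] at h

/-! ### The approximate identity -/

/-- A continuous periodic function is approximated near a point up to a multiple of
`1 - cos`. -/
theorem exists_abs_sub_le_add_mul_one_sub_cos {G : ℝ → ℝ}
    (hp : Function.Periodic G (2 * Real.pi)) (hc : Continuous G) (x : ℝ) {ε : ℝ} (hε : 0 < ε) :
    ∃ C, 0 ≤ C ∧ ∀ φ, |G (φ + x) - G x| ≤ ε + C * (1 - Real.cos φ) := by
  obtain ⟨B, hB⟩ : ∃ B, ∀ φ, |G φ| ≤ B := by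
    obtain ⟨B, hB⟩ := (hp.isBounded_of_continuous (by positivity) hc).exists_norm_le
    exact ⟨B, fun φ => hB _ ⟨φ, rfl⟩⟩
  have hB0 : 0 ≤ B := (abs_nonneg _).trans (hB 0)
  obtain ⟨δ, hδ, H⟩ := Metric.continuousAt_iff.1 (hc.continuousAt (x := x)) ε hε
  obtain ⟨η, hη0, hηδ, hηπ⟩ : ∃ η > 0, η < δ ∧ η < Real.pi :=
    ⟨min δ Real.pi / 2, by have := Real.pi_pos; positivity, by
      linarith [min_le_left δ Real.pi, lt_min hδ Real.pi_pos], by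
      linarith [min_le_right δ Real.pi, lt_min hδ Real.pi_pos]⟩
  have hcos : 0 < 1 - Real.cos η := by
    have := Real.cos_lt_cos_of_nonneg_of_le_pi le_rfl hηπ.le hη0
    rw [Real.cos_zero] at this
    linarith
  -- For |φ| ≥ δ > η within one period the difference is at most 2B while 1 - cos φ ≥ 1 - cos η; for
  -- |φ| < δ continuity alone gives ε.
  refine ⟨2 * B / (1 - Real.cos η), by positivity, ?_⟩
  have key : ∀ φ ∈ Ioc (-Real.pi) (-Real.pi + 2 * Real.pi), |G (φ + x) - G x| ≤
      ε + 2 * B / (1 - Real.cos η) * (1 - Real.cos φ) := by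
    intro φ hφ
    have h1 := sub_nonneg.2 (Real.cos_le_one φ)
    rcases lt_or_ge |φ| δ with h | h
    · have := H (x := φ + x) (by simpa using h)
      rw [Real.dist_eq] at this
      have h2 : 0 ≤ 2 * B / (1 - Real.cos η) * (1 - Real.cos φ) := by positivity
      linarith
    · have h2 : Real.cos φ ≤ Real.cos η := by
        rw [← Real.cos_abs φ]
        exact Real.cos_le_cos_of_nonneg_of_le_pi hη0.le
          (abs_le.2 ⟨hφ.1.le, by linarith [hφ.2]⟩) (by linarith)
      have h3 : 2 * B ≤ 2 * B / (1 - Real.cos η) * (1 - Real.cos φ) := by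
        rw [div_mul_eq_mul_div, le_div_iff₀ hcos]
        exact mul_le_mul_of_nonneg_left (by linarith) (by linarith)
      linarith [abs_sub (G (φ + x)) (G x), hB (φ + x), hB x]
  intro φ
  have h := key _ (toIocMod_mem_Ioc Real.two_pi_pos (-Real.pi) φ)
  have e1 : G (toIocMod Real.two_pi_pos (-Real.pi) φ + x) = G (φ + x) := by
    rw [toIocMod, sub_add_eq_add_sub, hp.sub_zsmul_eq]
  have e2 : Real.cos (toIocMod Real.two_pi_pos (-Real.pi) φ) = Real.cos φ := by
    rw [toIocMod, Real.cos_periodic.sub_zsmul_eq]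
  rwa [e1, e2] at h

/-- The Poisson kernels form an approximate identity. -/
theorem tendsto_integral_circlePoissonKernel_mul {G : ℝ → ℝ}
    (hp : Function.Periodic G (2 * Real.pi)) (hc : Continuous G) (x : ℝ) :
    Tendsto (fun r => ∫ φ in (0)..(2 * Real.pi), circlePoissonKernel r φ * G (φ + x))
      (𝓝[<] 1) (𝓝 (G x)) := by
  rw [Metric.tendsto_nhds]
  intro ε hε
  -- Against the kernel, the constant ε/2 integrates to ε/2, and C(1 - cos φ) contributes at most
  -- the quantity that `hlim` sends to 0.
  obtain ⟨C, hC, H⟩ := exists_abs_sub_le_add_mul_one_sub_cos hp hc x (half_pos hε)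
  have hlim : Tendsto (fun r : ℝ => C * ((1 - r ^ 2) / (4 * Real.pi * r)) * (2 * Real.pi))
      (𝓝[<] 1) (𝓝 0) := by
    have : ContinuousAt (fun r : ℝ => C * ((1 - r ^ 2) / (4 * Real.pi * r)) * (2 * Real.pi)) 1 := by
      refine ContinuousAt.mul (continuousAt_const.mul (ContinuousAt.div (by fun_prop)
        (by fun_prop) ?_)) continuousAt_const
      have := Real.pi_pos
      positivity
    simpa [ContinuousAt] using this.tendsto.mono_left nhdsWithin_le_nhds
  filter_upwards [hlim.eventually (gt_mem_nhds (half_pos hε)),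
    Ioo_mem_nhdsLT (show (0 : ℝ) < 1 by norm_num)] with r hr1 hr
  have hK := continuous_circlePoissonKernel hr.1.le hr.2
  have hG : Continuous fun φ => G (φ + x) := by fun_prop
  have e : (∫ φ in (0)..(2 * Real.pi), circlePoissonKernel r φ * G (φ + x)) - G x =
      ∫ φ in (0)..(2 * Real.pi), circlePoissonKernel r φ * (G (φ + x) - G x) := by
    simp only [mul_sub]
    rw [intervalIntegral.integral_sub (f := fun φ => circlePoissonKernel r φ * G (φ + x))
      (g := fun φ => circlePoissonKernel r φ * G x) ((hK.mul hG).intervalIntegrable _ _)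
      ((hK.mul continuous_const).intervalIntegrable _ _), intervalIntegral.integral_mul_const,
      integral_circlePoissonKernel hr.1.le hr.2, one_mul]
  rw [Real.dist_eq, e]
  calc |∫ φ in (0)..(2 * Real.pi), circlePoissonKernel r φ * (G (φ + x) - G x)|
      ≤ ∫ φ in (0)..(2 * Real.pi), |circlePoissonKernel r φ * (G (φ + x) - G x)| :=
        intervalIntegral.abs_integral_le_integral_abs Real.two_pi_pos.le
    _ ≤ ∫ φ in (0)..(2 * Real.pi), (circlePoissonKernel r φ * (ε / 2) +
          C * ((1 - r ^ 2) / (4 * Real.pi * r))) := by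
        refine intervalIntegral.integral_mono Real.two_pi_pos.le
          (Continuous.intervalIntegrable (by fun_prop) _ _)
          (Continuous.intervalIntegrable (by fun_prop) _ _) fun φ => ?_
        have hk := circlePoissonKernel_nonneg hr.1.le hr.2 φ
        have h1 := mul_le_mul_of_nonneg_left (H φ) hk
        have h2 := mul_le_mul_of_nonneg_left
          (circlePoissonKernel_mul_one_sub_cos_le hr.1 hr.2 φ) hC
        simp only [abs_mul, abs_of_nonneg hk]
        linarith
    _ = ε / 2 + C * ((1 - r ^ 2) / (4 * Real.pi * r)) * (2 * Real.pi) := by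
        rw [intervalIntegral.integral_add (Continuous.intervalIntegrable (by fun_prop) _ _)
          (by simp), intervalIntegral.integral_mul_const,
          integral_circlePoissonKernel hr.1.le hr.2, intervalIntegral.integral_const]
        simp only [smul_eq_mul]
        ring
    _ < ε := by linarith

theorem hkIntegral_eq_intervalIntegral {q : ℝ → ℝ} (hq : Continuous q) {a b : ℝ} (hab : a ≤ b) :
    hkIntegral q a b = ∫ x in a..b, q x := by
  rw [hkIntegral_of_hasDerivAt (Q := fun x => ∫ t in (0)..x, q t)
    (fun x => hq.integral_hasStrictDerivAt 0 x |>.hasDerivAt) hab]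
  exact intervalIntegral.integral_interval_sub_left (hq.intervalIntegrable _ _)
    (hq.intervalIntegrable _ _)

end PoissonHK

namespace PoissonHK

open Set Filter Topology Complex MeasureTheory

/-! ### The Herglotz integral of a continuous periodic function -/

/-- The holomorphic function on the disc whose real part is the Poisson integral of the
`2π`-periodic function `G`. -/
noncomputable def herglotzIntegral (G : ℝ → ℝ) (w : ℂ) : ℂ :=
  Real.circleAverage (fun ζ => herglotzRieszKernel 0 w ζ • (G (arg ζ) : ℂ)) 0 1

/-- The derivative of `herglotzIntegral G`. -/
noncomputable def herglotzIntegralDeriv (G : ℝ → ℝ) (w : ℂ) : ℂ :=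
  Real.circleAverage (fun ζ => (2 * ζ / (ζ - w) ^ 2) • (G (arg ζ) : ℂ)) 0 1

section Periodic

variable {G : ℝ → ℝ}

theorem apply_arg_circleMap (hp : Function.Periodic G (2 * Real.pi)) (φ : ℝ) :
    G (arg (circleMap 0 1 φ)) = G φ := by
  rw [circleMap, zero_add, ofReal_one, one_mul, arg_exp_mul_I, toIocMod, hp.sub_zsmul_eq]

theorem circleIntegrable_comp_arg (hp : Function.Periodic G (2 * Real.pi)) (hc : Continuous G) :
    CircleIntegrable (fun ζ => (G (arg ζ) : ℂ)) 0 1 := by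
  simp only [CircleIntegrable, apply_arg_circleMap hp]
  exact (continuous_ofReal.comp hc).intervalIntegrable _ _

theorem hasDerivAt_herglotzIntegral (hp : Function.Periodic G (2 * Real.pi)) (hc : Continuous G)
    {w : ℂ} (hw : w ∈ Metric.ball (0 : ℂ) 1) :
    HasDerivAt (herglotzIntegral G) (herglotzIntegralDeriv G w) w :=
  hasDerivAt_circleAverage_herglotzRieszKernel_smul (circleIntegrable_comp_arg hp hc) hw

theorem analyticOnNhd_herglotzIntegralDeriv (hp : Function.Periodic G (2 * Real.pi))
    (hc : Continuous G) : AnalyticOnNhd ℂ (herglotzIntegralDeriv G) (Metric.ball 0 1) := by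
  have h : AnalyticOnNhd ℂ (herglotzIntegral G) (Metric.ball 0 1) :=
    analyticOnNhd_circleAverage_herglotzRieszKernel_smul (circleIntegrable_comp_arg hp hc)
  refine h.deriv.congr Metric.isOpen_ball fun w hw => ?_
  exact (hasDerivAt_herglotzIntegral hp hc hw).deriv

/-- Used for the kernel itself with c = 1, and for its w-derivative with c = -(i w). -/
theorem re_circleAverage_mul_comp_arg (hp : Function.Periodic G (2 * Real.pi)) (hc : Continuous G)
    {q : ℂ → ℂ} (hq : Continuous fun φ : ℝ => q (circleMap 0 1 φ)) (c : ℂ) :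
    (c * Real.circleAverage (fun ζ => q ζ • (G (arg ζ) : ℂ)) 0 1).re =
      ∫ φ in (0)..(2 * Real.pi), G φ * ((c * q (circleMap 0 1 φ)).re / (2 * Real.pi)) := by
  rw [Real.circleAverage_def]
  simp only [apply_arg_circleMap hp, smul_eq_mul, real_smul]
  rw [← intervalIntegral.integral_const_mul, ← intervalIntegral.integral_const_mul]
  have h := reCLM.intervalIntegral_comp_comm (μ := volume) (a := 0) (b := 2 * Real.pi)
    (f := fun φ : ℝ => c * (((2 * Real.pi)⁻¹ : ℝ) * (q (circleMap 0 1 φ) * (G φ : ℂ))))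
    ((continuous_const.mul (continuous_const.mul (hq.mul
      (continuous_ofReal.comp hc)))).intervalIntegrable _ _)
  simp only [reCLM_apply] at h
  rw [← h]
  refine intervalIntegral.integral_congr fun φ _ => ?_
  have : c * (((2 * Real.pi)⁻¹ : ℝ) * (q (circleMap 0 1 φ) * (G φ : ℂ))) =
      ((G φ * (2 * Real.pi)⁻¹ : ℝ) : ℂ) * (c * q (circleMap 0 1 φ)) := by
    push_cast; ring
  simp only [this, re_ofReal_mul]
  ring

theorem re_herglotzIntegral (hp : Function.Periodic G (2 * Real.pi)) (hc : Continuous G)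
    {r : ℝ} (h0 : 0 ≤ r) (h1 : r < 1) (θ : ℝ) :
    (herglotzIntegral G (r * exp (θ * I))).re =
      ∫ φ in (0)..(2 * Real.pi), circlePoissonKernel r φ * G (φ + θ) := by
  have hw := ofReal_mul_exp_mem_disc h0 h1 θ
  have h := re_circleAverage_mul_comp_arg hp hc (continuous_herglotzRieszKernel_circleMap hw) 1
  simp only [one_mul, ← circlePoissonKernel_eq] at h
  rw [herglotzIntegral, h]
  have hper : Function.Periodic (fun φ => circlePoissonKernel r (φ - θ) * G φ) (2 * Real.pi) :=
    fun φ => by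
      simp only [hp φ, add_sub_right_comm, periodic_circlePoissonKernel r (φ - θ)]
  have h2 := integral_eq_of_periodic hper θ 0
  have h3 := intervalIntegral.integral_comp_add_right (a := 0) (b := 2 * Real.pi)
    (fun φ => circlePoissonKernel r (φ - θ) * G φ) θ
  simp only [zero_add, add_sub_cancel_right] at h2 h3
  rw [h3, add_comm (2 * Real.pi), h2]
  simp only [mul_comm]

end Periodic

/-! ### The Poisson integral through the periodic part of the primitive -/

/-- The indefinite integral of a periodic function minus its linear part. -/
noncomputable def periodicPart (f : ℝ → ℝ) (x : ℝ) : ℝ :=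
  hkPrimitive f x - hkPrimitive f (2 * Real.pi) / (2 * Real.pi) * x

section

variable {f : ℝ → ℝ}

theorem periodic_periodicPart (hT : Function.Periodic f (2 * Real.pi))
    (hf : ∀ a b, HKIntegrable f a b) : Function.Periodic (periodicPart f) (2 * Real.pi) := by
  intro x
  have := Real.pi_pos.ne'
  simp only [periodicPart, hkPrimitive_add_period hT hf]
  field_simp
  ring

theorem continuous_periodicPart (hf : ∀ a b, HKIntegrable f a b) :
    Continuous (periodicPart f) :=
  (continuous_hkPrimitive hf).sub (by fun_prop)

/-- Integrate by parts over [-π, π]. The boundary term is c k(π), as F(π) = F(-π) + c and k(-π) =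
k(π). The linear part of F gives c/(2π) times (2π k(π) - 1), which cancels it and leaves c/(2π); the
periodic part gives the Herglotz term. -/
theorem hkIntegrable_and_poissonIntegral_eq (hT : Function.Periodic f (2 * Real.pi))
    (hf : ∀ a b, HKIntegrable f a b) {w : ℂ} (hw : w ∈ Metric.ball (0 : ℂ) 1) :
    HKIntegrable (fun φ => f φ * circlePoissonKernel ‖w‖ (φ - arg w)) (-Real.pi) Real.pi ∧
    poissonIntegral f w = hkPrimitive f (2 * Real.pi) / (2 * Real.pi) +
      (I * w * herglotzIntegralDeriv (periodicPart f) w).re := by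
  have h1 : ‖w‖ < 1 := by simpa using hw
  have hpi := Real.pi_pos
  set k : ℝ → ℝ := fun φ => circlePoissonKernel ‖w‖ (φ - arg w) with hk
  set D : ℝ → ℂ := fun φ => 2 * circleMap 0 1 φ / (circleMap 0 1 φ - w) ^ 2 with hD
  set k' : ℝ → ℝ := fun φ => (-(I * w) * D φ).re / (2 * Real.pi) with hk'
  have hDc : Continuous D := Continuous.div (by fun_prop) (by fun_prop)
    fun φ => pow_ne_zero _ (circleMap_sub_ne_zero hw φ)
  have hk'c : Continuous k' := by fun_prop
  have hkc : Continuous k :=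
    (continuous_circlePoissonKernel (norm_nonneg _) h1).comp (by fun_prop)
  have hkp : Function.Periodic k (2 * Real.pi) := fun φ => by
    simp only [hk, add_sub_right_comm, periodic_circlePoissonKernel _ (φ - arg w)]
  have hk'p : Function.Periodic k' (2 * Real.pi) := fun φ => by
    simp only [hk', hD, periodic_circleMap 0 1 φ]
  have hkd : ∀ φ, HasDerivAt k (k' φ) φ := fun φ => by
    have h := (reCLM.hasFDerivAt.comp_hasDerivAt φ
      (hasDerivAt_herglotzRieszKernel_circleMap hw φ)).div_const (2 * Real.pi)
    simp only [hk, circlePoissonKernel_arg, hk', hD, neg_mul]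
    exact h
  have hkM : ∃ M, ∀ φ, |k φ| ≤ M := by
    obtain ⟨M, hM⟩ := (hkp.isBounded_of_continuous (by positivity) hkc).exists_norm_le
    exact ⟨M, fun φ => hM _ ⟨φ, rfl⟩⟩
  obtain ⟨M, hM⟩ := hkM
  have hFc := continuous_hkPrimitive hf
  have hQ : ∀ x, HasDerivAt (fun x => ∫ t in (0)..x, hkPrimitive f t * k' t)
      (hkPrimitive f x * k' x) x := fun x =>
    ((hFc.mul hk'c).integral_hasStrictDerivAt 0 x).hasDerivAt
  refine ⟨hkIntegrable_mul hf hM hkd hQ _ _, ?_⟩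
  rw [poissonIntegral]
  refine (hkIntegral_mul hf hM hkd hQ (by linarith)).trans ?_
  have hGc := continuous_periodicPart hf
  have hGp := periodic_periodicPart hT hf
  set c := hkPrimitive f (2 * Real.pi) with hcdef
  have e1 : (∫ t in (0)..Real.pi, hkPrimitive f t * k' t) -
      (∫ t in (0)..(-Real.pi), hkPrimitive f t * k' t) =
        ∫ t in (-Real.pi)..Real.pi, hkPrimitive f t * k' t :=
    intervalIntegral.integral_interval_sub_left ((hFc.mul hk'c).intervalIntegrable _ _)
      ((hFc.mul hk'c).intervalIntegrable _ _)
  have e2 : ∫ t in (-Real.pi)..Real.pi, hkPrimitive f t * k' t =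
      (∫ t in (-Real.pi)..Real.pi, periodicPart f t * k' t) +
        c / (2 * Real.pi) * ∫ t in (-Real.pi)..Real.pi, t * k' t := by
    rw [← intervalIntegral.integral_const_mul, ← intervalIntegral.integral_add
      (Continuous.intervalIntegrable (by fun_prop) _ _)
      (Continuous.intervalIntegrable (by fun_prop) _ _)]
    refine intervalIntegral.integral_congr fun t _ => ?_
    simp only [periodicPart]
    ring
  have e3 : ∫ t in (-Real.pi)..Real.pi, t * k' t =
      Real.pi * k Real.pi - (-Real.pi) * k (-Real.pi) - ∫ t in (-Real.pi)..Real.pi, k t := by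
    have := intervalIntegral.integral_mul_deriv_eq_deriv_mul (a := -Real.pi) (b := Real.pi)
      (fun x _ => hasDerivAt_id x) (fun x _ => hkd x) (by simp) (hk'c.intervalIntegrable _ _)
    simpa using this
  have e4 : ∫ t in (-Real.pi)..Real.pi, k t = 1 := by
    rw [integral_neg_pi_pi_eq hkp, ← integral_circlePoissonKernel (norm_nonneg w) h1,
      ← zero_add (2 * Real.pi), ← integral_eq_of_periodic hkp (arg w)]
    have h3 := intervalIntegral.integral_comp_sub_right (a := arg w) (b := arg w + 2 * Real.pi)
      (circlePoissonKernel ‖w‖) (arg w)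
    rw [hk, h3]
    simp
  have e5 : ∫ t in (-Real.pi)..Real.pi, periodicPart f t * k' t =
      -(I * w * herglotzIntegralDeriv (periodicPart f) w).re := by
    rw [integral_neg_pi_pi_eq (fun t => by simp only [hGp t, hk'p t]), ← neg_re, ← neg_mul,
      herglotzIntegralDeriv, re_circleAverage_mul_comp_arg hGp hGc hDc]
  have e6 : k (-Real.pi) = k Real.pi := by
    rw [← hkp (-Real.pi)]; congr 1; ring
  have e7 : hkPrimitive f Real.pi = hkPrimitive f (-Real.pi) + c := by
    rw [← hkPrimitive_add_period hT hf]; congr 1; ring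
  have e8 : c / (2 * Real.pi) * Real.pi = c / 2 := by field_simp
  rw [e6] at e3 ⊢
  rw [e5, e3, e4] at e2
  rw [e2] at e1
  rw [e7]
  linear_combination (-1 : ℝ) * e1 - 2 * k Real.pi * e8

/-- Since d/dθ of w = re^{iθ} is i w, the term Re(i w H'(w)) is exactly the θ-derivative of Re
H(re^{iθ}). -/
theorem circleSlice_poissonIntegral_hasDerivAt (hT : Function.Periodic f (2 * Real.pi))
    (hf : ∀ a b, HKIntegrable f a b) {r : ℝ} (h0 : 0 ≤ r) (h1 : r < 1) (θ : ℝ) :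
    HasDerivAt (fun θ : ℝ => hkPrimitive f (2 * Real.pi) / (2 * Real.pi) * θ +
      (herglotzIntegral (periodicPart f) (r * exp (θ * I))).re)
      (circleSlice (poissonIntegral f) r θ) θ := by
  have hw := ofReal_mul_exp_mem_disc h0 h1 θ
  have h := hasDerivAt_herglotzIntegral (periodic_periodicPart hT hf)
    (continuous_periodicPart hf) hw
  have hexp : HasDerivAt (fun θ : ℝ => (r * exp (θ * I) : ℂ)) (I * (r * exp (θ * I))) θ := by
    have h1 : HasDerivAt (fun θ : ℝ => (θ * I : ℂ)) (1 * I) θ :=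
      (ofRealCLM.hasDerivAt (x := θ)).mul_const I
    exact (h1.cexp.const_mul (r : ℂ)).congr_deriv (by ring)
  have h2 := reCLM.hasFDerivAt.comp_hasDerivAt θ (h.comp θ hexp)
  have h3 := ((hasDerivAt_id θ).const_mul
    (hkPrimitive f (2 * Real.pi) / (2 * Real.pi))).add h2
  rw [circleSlice, (hkIntegrable_and_poissonIntegral_eq hT hf hw).2]
  refine h3.congr_deriv ?_
  rw [mul_one, reCLM_apply, mul_comm (herglotzIntegralDeriv _ _)]

theorem hkIntegral_circleSlice_poissonIntegral (hT : Function.Periodic f (2 * Real.pi))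
    (hf : ∀ a b, HKIntegrable f a b) {r : ℝ} (h0 : 0 ≤ r) (h1 : r < 1) {a b : ℝ} (hab : a ≤ b) :
    hkIntegral (circleSlice (poissonIntegral f) r) a b =
      hkPrimitive f (2 * Real.pi) / (2 * Real.pi) * (b - a) +
      ((∫ φ in (0)..(2 * Real.pi), circlePoissonKernel r φ * periodicPart f (φ + b)) -
        ∫ φ in (0)..(2 * Real.pi), circlePoissonKernel r φ * periodicPart f (φ + a)) := by
  rw [hkIntegral_of_hasDerivAt (circleSlice_poissonIntegral_hasDerivAt hT hf h0 h1) hab,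
    re_herglotzIntegral (periodic_periodicPart hT hf) (continuous_periodicPart hf) h0 h1,
    re_herglotzIntegral (periodic_periodicPart hT hf) (continuous_periodicPart hf) h0 h1]
  ring

theorem hkIntegral_circleSlice_poissonIntegral_eq_average (hT : Function.Periodic f (2 * Real.pi))
    (hf : ∀ a b, HKIntegrable f a b) {r : ℝ} (h0 : 0 ≤ r) (h1 : r < 1) {a b : ℝ} (hab : a ≤ b) :
    hkIntegral (circleSlice (poissonIntegral f) r) a b =
      ∫ φ in (0)..(2 * Real.pi), circlePoissonKernel r φ * hkIntegral f (φ + a) (φ + b) := by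
  have hK := continuous_circlePoissonKernel h0 h1
  have hG := continuous_periodicPart hf
  rw [hkIntegral_circleSlice_poissonIntegral hT hf h0 h1 hab,
    ← intervalIntegral.integral_sub (Continuous.intervalIntegrable (by fun_prop) _ _)
      (Continuous.intervalIntegrable (by fun_prop) _ _)]
  -- The kernel has mass 1, so the linear term may be moved under the integral, where it recombines
  -- with the periodic part into F.
  have e : hkPrimitive f (2 * Real.pi) / (2 * Real.pi) * (b - a) =
      ∫ φ in (0)..(2 * Real.pi), circlePoissonKernel r φ *
        (hkPrimitive f (2 * Real.pi) / (2 * Real.pi) * (b - a)) := by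
    rw [intervalIntegral.integral_mul_const, integral_circlePoissonKernel h0 h1, one_mul]
  rw [e, ← intervalIntegral.integral_add (Continuous.intervalIntegrable (by fun_prop) _ _)
      (Continuous.intervalIntegrable (by fun_prop) _ _)]
  refine intervalIntegral.integral_congr fun φ _ => ?_
  simp only [hkIntegral_eq_sub hf (show φ + a ≤ φ + b by linarith), periodicPart]
  ring

theorem tendsto_hkIntegral_circleSlice_poissonIntegral (hT : Function.Periodic f (2 * Real.pi))
    (hf : ∀ a b, HKIntegrable f a b) {a b : ℝ} (hab : a ≤ b) :
    Tendsto (fun r => hkIntegral (circleSlice (poissonIntegral f) r) a b) (𝓝[<] 1)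
      (𝓝 (hkIntegral f a b)) := by
  have hp := periodic_periodicPart hT hf
  have hc := continuous_periodicPart hf
  have h := ((tendsto_integral_circlePoissonKernel_mul hp hc b).sub
    (tendsto_integral_circlePoissonKernel_mul hp hc a)).const_add
      (hkPrimitive f (2 * Real.pi) / (2 * Real.pi) * (b - a))
  have e : hkPrimitive f (2 * Real.pi) / (2 * Real.pi) * (b - a) +
      (periodicPart f b - periodicPart f a) = hkIntegral f a b := by
    rw [hkIntegral_eq_sub hf hab, periodicPart, periodicPart]; ring
  rw [e] at h
  refine h.congr' ?_
  filter_upwards [Ioo_mem_nhdsLT (show (0 : ℝ) < 1 by norm_num)] with r hr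
  exact (hkIntegral_circleSlice_poissonIntegral hT hf hr.1.le hr.2 hab).symm

/-- Near each point of the disc the Poisson integral is the real part of c/(2π) + i w H'(w), which
is analytic. -/
theorem harmonicOnNhd_poissonIntegral (hT : Function.Periodic f (2 * Real.pi))
    (hf : ∀ a b, HKIntegrable f a b) :
    InnerProductSpace.HarmonicOnNhd (poissonIntegral f) disc := by
  intro w hw
  have ha := analyticOnNhd_herglotzIntegralDeriv (periodic_periodicPart hT hf)
    (continuous_periodicPart hf) w hw
  have h : AnalyticAt ℂ (fun w => ((hkPrimitive f (2 * Real.pi) / (2 * Real.pi) : ℝ) : ℂ) +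
      I * w * herglotzIntegralDeriv (periodicPart f) w) w :=
    analyticAt_const.add ((analyticAt_const.mul analyticAt_id).mul ha)
  refine (InnerProductSpace.harmonicAt_congr_nhds ?_).2 h.harmonicAt_re
  filter_upwards [Metric.isOpen_ball.mem_nhds hw] with z hz
  rw [(hkIntegrable_and_poissonIntegral_eq hT hf hz).2]
  rw [add_re, ofReal_re]

end

/-! ### The isometry -/

theorem ofReal_abs_hkIntegral_le_alexiewiczNorm (f : ℝ → ℝ) {a b : ℝ} (hab : a ≤ b)
    (h : b - a ≤ 2 * Real.pi) : ENNReal.ofReal |hkIntegral f a b| ≤ alexiewiczNorm f :=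
  le_iSup_of_le a (le_iSup_of_le b (le_iSup_of_le ⟨hab, h⟩ le_rfl))

theorem abs_hkIntegral_le_alexiewiczNorm {f : ℝ → ℝ} (hf : alexiewiczNorm f < ⊤) {a b : ℝ}
    (hab : a ≤ b) (h : b - a ≤ 2 * Real.pi) : |hkIntegral f a b| ≤ (alexiewiczNorm f).toReal :=
  (ENNReal.ofReal_le_iff_le_toReal hf.ne).1 (ofReal_abs_hkIntegral_le_alexiewiczNorm f hab h)

theorem alexiewiczNorm_le {f : ℝ → ℝ} {C : ℝ≥0∞} (h : ∀ a b, a ≤ b → b - a ≤ 2 * Real.pi →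
    ENNReal.ofReal |hkIntegral f a b| ≤ C) : alexiewiczNorm f ≤ C :=
  iSup_le fun a => iSup_le fun b => iSup_le fun hab => h a b hab.1 hab.2

theorem alexiewiczNorm_circleSlice_le_hardyNorm (u : ℂ → ℝ) {r : ℝ} (h0 : 0 ≤ r) (h1 : r < 1) :
    alexiewiczNorm (circleSlice u r) ≤ hardyNorm u :=
  le_iSup_of_le r (le_iSup_of_le ⟨h0, h1⟩ le_rfl)

/-- For ≤, the translates [a + φ, b + φ] are as short as [a, b] and the kernel is a probability
density. For ≥, let r → 1 on each fixed interval. -/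
theorem hardyNorm_poissonIntegral {f : ℝ → ℝ} (hf : f ∈ HK) :
    hardyNorm (poissonIntegral f) = alexiewiczNorm f := by
  obtain ⟨hT, hI, hfin⟩ := hf
  apply le_antisymm
  · refine iSup_le fun r => iSup_le fun hr => alexiewiczNorm_le fun a b hab hab' => ?_
    rw [ENNReal.ofReal_le_iff_le_toReal hfin.ne,
      hkIntegral_circleSlice_poissonIntegral_eq_average hT hI hr.1 hr.2 hab]
    have hK := continuous_circlePoissonKernel hr.1 hr.2
    have hF := continuous_hkPrimitive hI
    have e : ∀ φ, hkIntegral f (φ + a) (φ + b) = hkPrimitive f (φ + b) - hkPrimitive f (φ + a) :=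
      fun φ => hkIntegral_eq_sub hI (by linarith)
    calc |∫ φ in (0)..(2 * Real.pi), circlePoissonKernel r φ * hkIntegral f (φ + a) (φ + b)|
        ≤ ∫ φ in (0)..(2 * Real.pi),
            |circlePoissonKernel r φ * hkIntegral f (φ + a) (φ + b)| :=
          intervalIntegral.abs_integral_le_integral_abs Real.two_pi_pos.le
      _ ≤ ∫ φ in (0)..(2 * Real.pi), circlePoissonKernel r φ * (alexiewiczNorm f).toReal := by
          refine intervalIntegral.integral_mono Real.two_pi_pos.le
            (Continuous.intervalIntegrable (by simp only [e]; fun_prop) _ _)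
            (Continuous.intervalIntegrable (by fun_prop) _ _) fun φ => ?_
          have hk := circlePoissonKernel_nonneg hr.1 hr.2 φ
          simp only [abs_mul, abs_of_nonneg hk]
          exact mul_le_mul_of_nonneg_left
            (abs_hkIntegral_le_alexiewiczNorm hfin (by linarith) (by linarith)) hk
      _ = (alexiewiczNorm f).toReal := by
          rw [intervalIntegral.integral_mul_const, integral_circlePoissonKernel hr.1 hr.2, one_mul]
  · refine alexiewiczNorm_le fun a b hab hab' => ?_
    refine le_of_tendsto (ENNReal.tendsto_ofReal
      (tendsto_hkIntegral_circleSlice_poissonIntegral hT hI hab).abs) ?_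
    filter_upwards [Ioo_mem_nhdsLT (show (0 : ℝ) < 1 by norm_num)] with r hr
    exact (ofReal_abs_hkIntegral_le_alexiewiczNorm _ hab hab').trans
      (alexiewiczNorm_circleSlice_le_hardyNorm _ hr.1.le hr.2)

theorem hkIntegrable_sub {f g : ℝ → ℝ} {a b : ℝ} (hf : HKIntegrable f a b)
    (hg : HKIntegrable g a b) : HKIntegrable (f - g) a b :=
  fun h => (hf h).sub (hg h)

theorem hkIntegral_sub {f g : ℝ → ℝ} {a b : ℝ} (hf : HKIntegrable f a b)
    (hg : HKIntegrable g a b) : hkIntegral (f - g) a b = hkIntegral f a b - hkIntegral g a b := by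
  unfold hkIntegral
  split_ifs with h
  · exact BoxIntegral.integral_sub (hf h) (hg h)
  · simp

theorem sub_mem_HK {f g : ℝ → ℝ} (hf : f ∈ HK) (hg : g ∈ HK) : f - g ∈ HK := by
  refine ⟨hf.1.sub hg.1, fun a b => hkIntegrable_sub (hf.2.1 a b) (hg.2.1 a b),
    (alexiewiczNorm_le fun a b hab hab' => ?_).trans_lt (ENNReal.add_lt_top.2 ⟨hf.2.2, hg.2.2⟩)⟩
  rw [hkIntegral_sub (hf.2.1 a b) (hg.2.1 a b)]
  exact (ENNReal.ofReal_le_ofReal (abs_sub _ _)).trans <| ENNReal.ofReal_add_le.trans <|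
    add_le_add (ofReal_abs_hkIntegral_le_alexiewiczNorm f hab hab')
      (ofReal_abs_hkIntegral_le_alexiewiczNorm g hab hab')

theorem poissonIntegral_sub {f g : ℝ → ℝ} (hf : f ∈ HK) (hg : g ∈ HK) {w : ℂ} (hw : w ∈ disc) :
    poissonIntegral (f - g) w = poissonIntegral f w - poissonIntegral g w := by
  unfold poissonIntegral
  rw [← hkIntegral_sub (hkIntegrable_and_poissonIntegral_eq hf.1 hf.2.1 hw).1
    (hkIntegrable_and_poissonIntegral_eq hg.1 hg.2.1 hw).1]
  congr 1
  ext φ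
  simp [sub_mul]

theorem circleSlice_congr {u v : ℂ → ℝ} (h : EqOn u v disc) {r : ℝ} (h0 : 0 ≤ r) (h1 : r < 1) :
    circleSlice u r = circleSlice v r :=
  funext fun θ => h (ofReal_mul_exp_mem_disc h0 h1 θ)

theorem hardyNorm_congr {u v : ℂ → ℝ} (h : EqOn u v disc) : hardyNorm u = hardyNorm v :=
  iSup_congr fun r => iSup_congr fun hr => by rw [circleSlice_congr h hr.1 hr.2]

/-! ### The range is not everything -/

/-- The Poisson kernel as a function on the disc, with pole at `1`. -/
noncomputable def discPoissonKernel (z : ℂ) : ℝ :=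
  (herglotzRieszKernel 0 z 1).re / (2 * Real.pi)

theorem circleSlice_discPoissonKernel (r : ℝ) :
    circleSlice discPoissonKernel r = circlePoissonKernel r := by
  ext θ
  have h := circlePoissonKernel_eq (r := r) θ 0
  rw [zero_sub, circlePoissonKernel_neg] at h
  rw [h, circleSlice, discPoissonKernel]
  simp [circleMap]

theorem harmonicOnNhd_discPoissonKernel :
    InnerProductSpace.HarmonicOnNhd discPoissonKernel disc := by
  intro w hw
  have hw1 : (1 : ℂ) - w ≠ 0 := by
    have := circleMap_sub_ne_zero hw 0
    simpa [circleMap] using this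
  have h : AnalyticAt ℂ (fun z : ℂ => ((2 * Real.pi)⁻¹ : ℝ) * ((1 + z) / (1 - z))) w :=
    analyticAt_const.mul ((analyticAt_const.add analyticAt_id).div
      (analyticAt_const.sub analyticAt_id) hw1)
  convert h.harmonicAt_re using 1
  ext z
  rw [re_ofReal_mul, discPoissonKernel, herglotzRieszKernel_def, sub_zero, sub_zero]
  ring

/-- The slices are nonnegative with mass 1 over a period, so no admissible interval carries more
than 1. -/
theorem hardyNorm_discPoissonKernel_lt_top : hardyNorm discPoissonKernel < ⊤ := by
  refine lt_of_le_of_lt (iSup_le fun r => iSup_le fun hr =>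
    alexiewiczNorm_le fun a b hab hab' => ?_) ENNReal.one_lt_top
  have hK := continuous_circlePoissonKernel hr.1 hr.2
  rw [circleSlice_discPoissonKernel, hkIntegral_eq_intervalIntegral hK hab,
    ENNReal.ofReal_le_one, abs_of_nonneg (intervalIntegral.integral_nonneg hab
      fun φ _ => circlePoissonKernel_nonneg hr.1 hr.2 φ),
    ← integral_circlePoissonKernel hr.1 hr.2]
  have h := integral_eq_of_periodic (periodic_circlePoissonKernel r) a 0
  rw [zero_add] at h
  rw [← h]
  exact intervalIntegral.integral_mono_interval le_rfl hab (by linarith)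
    (Eventually.of_forall fun φ => circlePoissonKernel_nonneg hr.1 hr.2 φ)
    (hK.intervalIntegrable _ _)

/-- Away from its pole the Poisson kernel converges to zero. -/
theorem tendsto_integral_circlePoissonKernel_zero {δ : ℝ} (h0 : 0 < δ) (hδ : δ < Real.pi) :
    Tendsto (fun r => ∫ φ in δ..(2 * Real.pi - δ), circlePoissonKernel r φ) (𝓝[<] 1) (𝓝 0) := by
  have hcos : 0 < 1 - Real.cos δ := by
    have := Real.cos_lt_cos_of_nonneg_of_le_pi le_rfl hδ.le h0
    rw [Real.cos_zero] at this
    linarith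
  have hab : δ ≤ 2 * Real.pi - δ := by linarith
  have hlim : Tendsto (fun r : ℝ => (1 - r ^ 2) / (4 * Real.pi * r) / (1 - Real.cos δ) *
      (2 * Real.pi - δ - δ)) (𝓝[<] 1) (𝓝 0) := by
    have : ContinuousAt (fun r : ℝ => (1 - r ^ 2) / (4 * Real.pi * r) / (1 - Real.cos δ) *
        (2 * Real.pi - δ - δ)) 1 := by
      refine ContinuousAt.mul (ContinuousAt.div_const (ContinuousAt.div (by fun_prop)
        (by fun_prop) ?_) _) continuousAt_const
      have := Real.pi_pos
      positivity
    simpa [ContinuousAt] using this.tendsto.mono_left nhdsWithin_le_nhds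
  have hmem := Ioo_mem_nhdsLT (show (0 : ℝ) < 1 by norm_num)
  refine tendsto_of_tendsto_of_tendsto_of_le_of_le' tendsto_const_nhds hlim ?_ ?_
  · filter_upwards [hmem] with r hr
    exact intervalIntegral.integral_nonneg hab
      fun φ _ => circlePoissonKernel_nonneg hr.1.le hr.2 φ
  · filter_upwards [hmem] with r hr
    have hK := continuous_circlePoissonKernel hr.1.le hr.2
    calc ∫ φ in δ..(2 * Real.pi - δ), circlePoissonKernel r φ
        ≤ ∫ _ in δ..(2 * Real.pi - δ), (1 - r ^ 2) / (4 * Real.pi * r) / (1 - Real.cos δ) := by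
          refine intervalIntegral.integral_mono_on hab (hK.intervalIntegrable _ _) (by simp)
            fun φ hφ => ?_
          rw [le_div_iff₀ hcos]
          refine le_trans (mul_le_mul_of_nonneg_left ?_
            (circlePoissonKernel_nonneg hr.1.le hr.2 φ))
            (circlePoissonKernel_mul_one_sub_cos_le hr.1 hr.2 φ)
          -- Cosine decreases only up to π; beyond that, reflect φ to 2π - φ.
          have : Real.cos φ ≤ Real.cos δ := by
            rcases le_total φ Real.pi with h | h
            · exact Real.cos_le_cos_of_nonneg_of_le_pi h0.le h hφ.1
            · rw [← Real.cos_two_pi_sub φ]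
              exact Real.cos_le_cos_of_nonneg_of_le_pi h0.le (by linarith) (by linarith [hφ.2])
          linarith
      _ = _ := by
          rw [intervalIntegral.integral_const, smul_eq_mul, mul_comm]

/-- For a preimage f, letting r → 1 gives F(2π) - F(0) = 1 but F(2π - δ) - F(δ) = 0 for small δ > 0,
against the continuity of F. -/
theorem not_eqOn_poissonIntegral_discPoissonKernel {f : ℝ → ℝ} (hf : f ∈ HK) :
    ¬ EqOn (poissonIntegral f) discPoissonKernel disc := by
  intro h
  obtain ⟨hT, hI, -⟩ := hf
  have hmem := Ioo_mem_nhdsLT (show (0 : ℝ) < 1 by norm_num)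
  have key : ∀ a b : ℝ, a ≤ b → Tendsto (fun r => ∫ φ in a..b, circlePoissonKernel r φ) (𝓝[<] 1)
      (𝓝 (hkPrimitive f b - hkPrimitive f a)) := by
    intro a b hab
    rw [← hkIntegral_eq_sub hI hab]
    refine (tendsto_hkIntegral_circleSlice_poissonIntegral hT hI hab).congr' ?_
    filter_upwards [hmem] with r hr
    rw [circleSlice_congr h hr.1.le hr.2, circleSlice_discPoissonKernel,
      hkIntegral_eq_intervalIntegral (continuous_circlePoissonKernel hr.1.le hr.2) hab]
  have h1 : hkPrimitive f (2 * Real.pi) - hkPrimitive f 0 = 1 := by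
    refine tendsto_nhds_unique (key _ _ Real.two_pi_pos.le) (tendsto_const_nhds.congr' ?_)
    filter_upwards [hmem] with r hr
    exact (integral_circlePoissonKernel hr.1.le hr.2).symm
  have h2 : ∀ δ ∈ Ioo 0 Real.pi, hkPrimitive f (2 * Real.pi - δ) - hkPrimitive f δ = 0 :=
    fun δ hδ => tendsto_nhds_unique (key _ _ (by linarith [hδ.2]))
      (tendsto_integral_circlePoissonKernel_zero hδ.1 hδ.2)
  have hF := continuous_hkPrimitive hI
  have h3 : Tendsto (fun δ => hkPrimitive f (2 * Real.pi - δ) - hkPrimitive f δ) (𝓝[>] 0)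
      (𝓝 (hkPrimitive f (2 * Real.pi - 0) - hkPrimitive f 0)) :=
    Tendsto.mono_left (Continuous.tendsto (by fun_prop) 0) nhdsWithin_le_nhds
  rw [sub_zero, h1] at h3
  refine zero_ne_one (tendsto_nhds_unique (tendsto_const_nhds.congr' ?_) h3)
  filter_upwards [Ioo_mem_nhdsGT Real.pi_pos] with δ hδ
  exact (h2 δ hδ).symm

end PoissonHK

/-- The Poisson integral is a well-defined isometry from `HK` into, but not onto, `hHK`. -/
theorem mainTheorem7 :
    (∀ f ∈ PoissonHK.HK,
      (∀ z ∈ PoissonHK.disc, PoissonHK.HKIntegrable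
        (fun φ => f φ * PoissonHK.circlePoissonKernel ‖z‖ (φ - Complex.arg z))
        (-Real.pi) Real.pi) ∧
      PoissonHK.poissonIntegral f ∈ PoissonHK.hHK ∧
      PoissonHK.hardyNorm (PoissonHK.poissonIntegral f) = PoissonHK.alexiewiczNorm f) ∧
    (∀ f ∈ PoissonHK.HK, ∀ g ∈ PoissonHK.HK,
      PoissonHK.hardyNorm (PoissonHK.poissonIntegral f - PoissonHK.poissonIntegral g) =
        PoissonHK.alexiewiczNorm (f - g)) ∧
    (∃ u ∈ PoissonHK.hHK, ∀ f ∈ PoissonHK.HK,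
      ¬ Set.EqOn (PoissonHK.poissonIntegral f) u PoissonHK.disc) := by

  refine ⟨fun f hf => ⟨fun z hz => ?_, ⟨?_, ?_⟩, ?_⟩, fun f hf g hg => ?_, ?_⟩
  · exact (PoissonHK.hkIntegrable_and_poissonIntegral_eq hf.1 hf.2.1 hz).1
  · exact PoissonHK.harmonicOnNhd_poissonIntegral hf.1 hf.2.1
  · rw [PoissonHK.hardyNorm_poissonIntegral hf]
    exact hf.2.2
  · exact PoissonHK.hardyNorm_poissonIntegral hf
  · rw [← PoissonHK.hardyNorm_poissonIntegral (PoissonHK.sub_mem_HK hf hg)]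
    exact PoissonHK.hardyNorm_congr fun w hw => (PoissonHK.poissonIntegral_sub hf hg hw).symm
  · exact ⟨PoissonHK.discPoissonKernel, ⟨PoissonHK.harmonicOnNhd_discPoissonKernel,
      PoissonHK.hardyNorm_discPoissonKernel_lt_top⟩,
      fun f hf => PoissonHK.not_eqOn_poissonIntegral_discPoissonKernel hf⟩
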